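/- Let $q:X\to S$ be a proper morphism of noetherian schemes, let $\mathcal E_1,\mathcal E_2$ be coherent $\mathcal O_X$-modules and let $N\ge 0$ be an integer. Let $\mathcal J^N(\mathcal E_1/S)$ be the $N$-th jet sheaf of $\mathcal E_1$ relative to $S$: the sheaf of $\mathcal O_X$-modules associated to the presheaf $$U\longmapsto \big(\mathcal O_X(U)\otimes_{A_U}\mathcal E_1(U)\big)\big/ I_U^{N+1}\cdot\big(\mathcal O_X(U)\otimes_{A_U}\mathcal E_1(U)\big),\qquad A_U=(q^{-1}\mathcal O_S)(U),$$ where $I_U$ is the kernel of the multiplication $\mathcal O_X(U)\otimes_{A_U}\mathcal O_X(U)\to\mathcal O_X(U)$ and $\mathcal O_X$ acts through the first factor. Let $d^N:\mathcal E_1\to\mathcal J^N(\mathcal E_1/S)$, $m\mapsto [1\otimes m]$, be the universal derivation. Let $D:\mathcal E_1\to\mathcal E_2$ be a differential operator of order $\le N$ relative to $S$, that is, an $\mathcal O_S$-linear map of sheaves of the form $D=\widetilde D\circ d^N$ with $\widetilde D:\mathcal J^N(\mathcal E_1/S)\to\mathcal E_2$ an $\mathcal O_X$-linear map. For $i\ge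 0$ let $R^iq_*$ be the $i$-th right derived functor of $q_*:\mathrm{Mod}(\mathcal O_X)\to\mathrm{Mod}(\mathcal O_S)$, let $R^iq_*^{\mathrm{Ab}}$ be the $i$-th right derived functor of $q_*$ on sheaves of abelian groups, and for an $\mathcal O_X$-module $\mathcal E$ let $c^i_{\mathcal E}:R^iq_*\mathcal E\to R^iq_*^{\mathrm{Ab}}\mathcal E$ be the canonical comparison morphism of sheaves of abelian groups (induced by a morphism over $\mathrm{id}_{\mathcal E}$ from an injective resolution of $\mathcal E$ by $\mathcal O_X$-modules to an injective resolution of $\mathcal E$ by sheaves of abelian groups). Then for every $i\ge 0$ the operator $D$ induces an $\mathcal O_S$-linear map $R^iD:R^iq_*\mathcal E_1\to R^iq_*\mathcal E_2$: there is a unique $\mathcal O_S$-linear map $R^iD$ such that $$c^i_{\mathcal E_2}\circ R^iD=R^iq_*^{\mathrm{Ab}}(D)\circ c^i_{\mathcal E_1}.$$ -/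

import Mathlib

open CategoryTheory Limits AlgebraicGeometry TopologicalSpace Opposite
open scoped TensorProduct

universe u

noncomputable section

namespace RelDiffOp

section SheavesOfModules

variable {T : TopCat.{u}} (R : CategoryTheory.Sheaf (Opens.grothendieckTopology T) RingCat.{u})

instance hasSeparator_sheafOfModules : HasSeparator (SheafOfModules.{u} R) where
  hasSeparator := by
    let adj := PresheafOfModules.sheafificationAdjunction (𝟙 R.obj)
    let S : Opens T → SheafOfModules.{u} R := fun U =>
      (PresheafOfModules.sheafification (𝟙 R.obj)).obj
        ((PresheafOfModules.free R.obj).obj (yoneda.obj U))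
    have hS : ObjectProperty.IsSeparating (ObjectProperty.ofObj S) := by
      intro F G f g hfg
      refine (SheafOfModules.forget R ⋙
        PresheafOfModules.restrictScalars (𝟙 R.obj)).map_injective
          (PresheafOfModules.freeYoneda.isSeparating R.obj _ _ ?_)
      rintro _ ⟨U⟩ a
      apply (adj.homEquiv _ _).symm.injective
      refine (adj.homEquiv_naturality_right_symm _ _).trans
        (Eq.trans ?_ (adj.homEquiv_naturality_right_symm _ _).symm)
      exact hfg _ (ObjectProperty.ofObj_apply _ U) ((adj.homEquiv _ _).symm a)
    exact ⟨_, hS.isSeparator_coproduct⟩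

instance hasExactColimitsOfShape_presheafOfModules (K : Type u) [SmallCategory K] [IsFiltered K] :
    HasExactColimitsOfShape K (PresheafOfModules.{u} R.obj) :=
  HasExactColimitsOfShape.domain_of_functor K (PresheafOfModules.toPresheaf R.obj)

instance hasExactColimitsOfShape_sheafOfModules (K : Type u) [SmallCategory K] [IsFiltered K] :
    HasExactColimitsOfShape K (SheafOfModules.{u} R) :=
  (PresheafOfModules.sheafificationAdjunction (𝟙 R.obj)).hasExactColimitsOfShape K

instance isGrothendieckAbelian_sheafOfModules : IsGrothendieckAbelian.{u} (SheafOfModules.{u} R) where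
  ab5OfSize := { ofShape := fun _ _ _ => inferInstance }

instance preservesFiniteColimits_toSheaf : PreservesFiniteColimits (SheafOfModules.toSheaf.{u} R) where
  preservesFiniteColimits K _ _ := {
    preservesColimit := fun {F} => by
      let a := PresheafOfModules.sheafification.{u} (𝟙 R.obj)
      let F' := F ⋙ SheafOfModules.forget R
      let e : F' ⋙ a ≅ F := Functor.isoWhiskerLeft F
        (asIso (PresheafOfModules.sheafificationAdjunction (𝟙 R.obj)).counit)
      have : PreservesColimit (F' ⋙ a) (SheafOfModules.toSheaf.{u} R) :=
        preservesColimit_of_preserves_colimit_cocone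
          (isColimitOfPreserves a (colimit.isColimit F'))
          (isColimitOfPreserves (PresheafOfModules.toPresheaf _ ⋙
            presheafToSheaf _ AddCommGrpCat.{u}) (colimit.isColimit F'))
      exact preservesColimit_of_iso_diagram _ e }

end SheavesOfModules

instance isGrothendieckAbelian_modules (X : Scheme.{u}) : IsGrothendieckAbelian.{u} X.Modules :=
  inferInstanceAs (IsGrothendieckAbelian.{u} (SheafOfModules X.ringCatSheaf))

/-- The functor taking a sheaf of `𝒪_X`-modules to its underlying sheaf of abelian groups. -/
def toAb (X : Scheme.{u}) : X.Modules ⥤ TopCat.Sheaf AddCommGrpCat.{u} X :=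
  SheafOfModules.toSheaf X.ringCatSheaf

instance preservesFiniteLimits_toAb (X : Scheme.{u}) : PreservesFiniteLimits (toAb X) :=
  inferInstanceAs (PreservesFiniteLimits (SheafOfModules.toSheaf X.ringCatSheaf))

instance preservesFiniteColimits_toAb (X : Scheme.{u}) : PreservesFiniteColimits (toAb X) :=
  inferInstanceAs (PreservesFiniteColimits (SheafOfModules.toSheaf X.ringCatSheaf))

instance additive_toAb (X : Scheme.{u}) : (toAb X).Additive where

/-- A coherent sheaf on a (noetherian) scheme: quasi-coherent and of finite type. -/
structure IsCoherent {X : Scheme.{u}} (E : X.Modules) : Prop where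
  isQuasicoherent : E.IsQuasicoherent
  isFiniteType : E.IsFiniteType

section JetAlgebra

variable (A B M : Type*) [CommRing A] [CommRing B] [Algebra A B] [AddCommGroup M]
  [Module A M] [Module B M] [IsScalarTower A B M]

/-- The action of `B ⊗[A] B` on `B ⊗[A] M`, given by `(b ⊗ c) • (b' ⊗ m) = (b * b') ⊗ (c • m)`. -/
def jetAct : B ⊗[A] B →ₐ[A] Module.End A (B ⊗[A] M) :=
  (Module.endTensorEndAlgHom (R := A) (S := A) (A := A) (M := B) (N := M)).comp
    (Algebra.TensorProduct.map (Algebra.lmul A B) (Algebra.lsmul A A M))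

@[simp]
lemma jetAct_tmul (b c b' : B) (m : M) :
    jetAct A B M (b ⊗ₜ c) (b' ⊗ₜ m) = (b * b') ⊗ₜ (c • m) := rfl

/-- The submodule `I ^ (N + 1) • (B ⊗[A] M)` of `B ⊗[A] M`, where `I` is the kernel of the
multiplication `B ⊗[A] B → B`; `B` acts through the first factor. -/
def jetSubmodule (N : ℕ) : Submodule B (B ⊗[A] M) :=
  Submodule.span B
    {w | ∃ x ∈ KaehlerDifferential.ideal A B ^ (N + 1), ∃ z : B ⊗[A] M, jetAct A B M x z = w}

/-- The jet module `J^N(M/A) = (B ⊗[A] M) / I ^ (N + 1) • (B ⊗[A] M)`, a `B`-module through the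
first factor. -/
abbrev Jet (N : ℕ) : Type _ := (B ⊗[A] M) ⧸ jetSubmodule A B M N

variable {A B M}
variable {A' B' M' : Type*} [CommRing A'] [CommRing B'] [Algebra A' B'] [AddCommGroup M']
  [Module A' M'] [Module B' M'] [IsScalarTower A' B' M']

/-- The map `B ⊗[A] M → B' ⊗[A'] M'` induced by compatible maps `A → A'`, `B → B'`, `M → M'`. -/
def tensorMap (f : A →+* A') (g : B →+* B')
    (hg : g.comp (algebraMap A B) = (algebraMap A' B').comp f) (ψ : M →ₛₗ[g] M') :
    B ⊗[A] M →ₛₗ[g] B' ⊗[A'] M' where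
  toFun := TensorProduct.liftAddHom
    { toFun := fun b =>
        { toFun := fun m => g b ⊗ₜ ψ m
          map_zero' := by simp
          map_add' := by simp [TensorProduct.tmul_add] }
      map_zero' := by ext; simp
      map_add' := by intros; ext; simp [TensorProduct.add_tmul] }
    (fun a b m => by
      have h (a : A) : g (algebraMap A B a) = algebraMap A' B' (f a) := RingHom.congr_fun hg a
      change g (a • b) ⊗ₜ[A'] ψ m = g b ⊗ₜ[A'] ψ (a • m)
      rw [← algebraMap_smul B a m, LinearMap.map_smulₛₗ, Algebra.smul_def, map_mul, h,
        ← Algebra.smul_def, algebraMap_smul, TensorProduct.smul_tmul])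
  map_add' := map_add _
  map_smul' b z := by
    induction z with
    | zero => simp
    | tmul b' m => simp [TensorProduct.smul_tmul']
    | add x y hx hy => simp only [smul_add, map_add, hx, hy]

@[simp]
lemma tensorMap_tmul (f : A →+* A') (g : B →+* B')
    (hg : g.comp (algebraMap A B) = (algebraMap A' B').comp f) (ψ : M →ₛₗ[g] M') (b : B) (m : M) :
    tensorMap f g hg ψ (b ⊗ₜ m) = g b ⊗ₜ ψ m := rfl

lemma tensorMap_jetAct (f : A →+* A') (g : B →+* B')
    (hg : g.comp (algebraMap A B) = (algebraMap A' B').comp f) (ψ : M →ₛₗ[g] M')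
    (x : B ⊗[A] B) (z : B ⊗[A] M) :
    tensorMap f g hg ψ (jetAct A B M x z) =
      jetAct A' B' M' (Algebra.TensorProduct.mapRingHom f g g hg hg x)
        (tensorMap f g hg ψ z) := by
  induction x with
  | zero => simp
  | add x y hx hy => simp only [map_add, LinearMap.add_apply, hx, hy]
  | tmul b c =>
    induction z with
    | zero => simp
    | add x y hx hy => simp only [map_add, hx, hy]
    | tmul b' m => simp

lemma mapRingHom_mem_ideal (f : A →+* A') (g : B →+* B')
    (hg : g.comp (algebraMap A B) = (algebraMap A' B').comp f) (n : ℕ) (x : B ⊗[A] B)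
    (hx : x ∈ KaehlerDifferential.ideal A B ^ n) :
    Algebra.TensorProduct.mapRingHom f g g hg hg x ∈ KaehlerDifferential.ideal A' B' ^ n := by
  have key : (KaehlerDifferential.ideal A B).map
      (Algebra.TensorProduct.mapRingHom f g g hg hg) ≤ KaehlerDifferential.ideal A' B' := by
    rw [Ideal.map_le_iff_le_comap]
    intro y hy
    have h2 : ∀ y : B ⊗[A] B, Algebra.TensorProduct.lmul' A'
        (Algebra.TensorProduct.mapRingHom f g g hg hg y) =
          g (Algebra.TensorProduct.lmul' A y) := by
      intro y
      induction y with
      | zero => simp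
      | add x y hx hy => simp only [map_add, hx, hy]
      | tmul b c => simp
    have hy' : Algebra.TensorProduct.lmul' A y = 0 := hy
    change Algebra.TensorProduct.lmul' A' _ = 0
    rw [h2, hy', map_zero]
  have := Ideal.mem_map_of_mem (Algebra.TensorProduct.mapRingHom f g g hg hg) hx
  rw [Ideal.map_pow] at this
  exact Ideal.pow_right_mono key n this

/-- The map of jet modules induced by compatible maps `A → A'`, `B → B'`, `M → M'`. -/
def jetMap (f : A →+* A') (g : B →+* B')
    (hg : g.comp (algebraMap A B) = (algebraMap A' B').comp f) (ψ : M →ₛₗ[g] M') (N : ℕ) :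
    Jet A B M N →ₛₗ[g] Jet A' B' M' N :=
  Submodule.mapQ _ _ (tensorMap f g hg ψ) (by
    refine Submodule.span_le.mpr ?_
    rintro _ ⟨x, hx, z, rfl⟩
    exact Submodule.subset_span ⟨_, mapRingHom_mem_ideal f g hg _ x hx, _,
      (tensorMap_jetAct f g hg ψ x z).symm⟩)

@[simp]
lemma jetMap_mk_tmul (f : A →+* A') (g : B →+* B')
    (hg : g.comp (algebraMap A B) = (algebraMap A' B').comp f) (ψ : M →ₛₗ[g] M') (N : ℕ)
    (b : B) (m : M) :
    jetMap f g hg ψ N (Submodule.Quotient.mk (b ⊗ₜ m)) =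
      Submodule.Quotient.mk (g b ⊗ₜ ψ m) := rfl

lemma jet_hom_ext {P : Type*} [AddCommGroup P] {N : ℕ} (φ χ : Jet A B M N →+ P)
    (h : ∀ (b : B) (m : M), φ (Submodule.Quotient.mk (b ⊗ₜ m)) =
      χ (Submodule.Quotient.mk (b ⊗ₜ m))) : φ = χ := by
  ext z
  obtain ⟨z, rfl⟩ := Submodule.Quotient.mk_surjective _ z
  induction z with
  | zero => simp
  | tmul b m => exact h b m
  | add x y hx hy => rw [Submodule.Quotient.mk_add, map_add, map_add, hx, hy]

end JetAlgebra

section JetSheaf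

variable {X S : Scheme.{u}} (q : X ⟶ S)

/-- The sheaf of rings `q⁻¹ 𝒪_S` on `X`. -/
def baseRing : TopCat.Sheaf CommRingCat.{u} X :=
  (TopCat.Sheaf.pullback CommRingCat.{u} q.base).obj S.sheaf

/-- The structure map `q⁻¹ 𝒪_S ⟶ 𝒪_X`, adjoint to `𝒪_S ⟶ q_* 𝒪_X`. -/
def baseRingHom : baseRing q ⟶ X.sheaf :=
  ((TopCat.Sheaf.pullbackPushforwardAdjunction CommRingCat.{u} q.base).homEquiv
    S.sheaf X.sheaf).symm ⟨q.c⟩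

instance baseRingAlgebra (U : X.Opens) : Algebra ((baseRing q).obj.obj (op U)) Γ(X, U) :=
  ((baseRingHom q).hom.app (op U)).hom.toAlgebra

variable (E : X.Modules)

instance baseRingModule (U : X.Opens) : Module ((baseRing q).obj.obj (op U)) Γ(E, U) :=
  Module.compHom Γ(E, U) (algebraMap ((baseRing q).obj.obj (op U)) Γ(X, U))

instance baseRingScalarTower (U : X.Opens) : IsScalarTower ((baseRing q).obj.obj (op U)) Γ(X, U) Γ(E, U) where
  smul_assoc a b m := by
    rw [Algebra.smul_def, mul_smul]; rfl

/-- The jet module of the `𝒪_X(U)`-module `E(U)` relative to `(q⁻¹ 𝒪_S)(U)`. -/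
abbrev JetSections (N : ℕ) (U : X.Opens) : Type u :=
  Jet ((baseRing q).obj.obj (op U)) Γ(X, U) Γ(E, U) N

/-- The class of `b ⊗ m` in the jet module. -/
def jetMk (N : ℕ) (U : X.Opens) (b : Γ(X, U)) (m : Γ(E, U)) : JetSections q E N U :=
  Submodule.Quotient.mk (b ⊗ₜ m)

/-- Restriction of sections, as a semilinear map. -/
def restrictionMap {U V : X.Opens} (i : V ⟶ U) :
    Γ(E, U) →ₛₗ[(X.presheaf.map i.op).hom] Γ(E, V) where
  toFun := E.presheaf.map i.op
  map_add' := by simp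
  map_smul' r x := E.map_smul i r x

/-- Restriction maps between the jet modules. -/
def jetRestriction (N : ℕ) {U V : X.Opens} (i : V ⟶ U) :
    JetSections q E N U →ₛₗ[(X.presheaf.map i.op).hom] JetSections q E N V :=
  jetMap ((baseRing q).obj.map i.op).hom (X.presheaf.map i.op).hom
    (congrArg CommRingCat.Hom.hom ((baseRingHom q).hom.naturality i.op).symm)
    (restrictionMap E i) N

/-- The presheaf of abelian groups `U ↦ J^N(E(U) / (q⁻¹ 𝒪_S)(U))`. -/
def jetPresheafAb (N : ℕ) : X.Opensᵒᵖ ⥤ AddCommGrpCat.{u} where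
  obj U := AddCommGrpCat.of (JetSections q E N U.unop)
  map i := AddCommGrpCat.ofHom (jetRestriction q E N i.unop).toAddMonoidHom
  map_id U := by
    refine AddCommGrpCat.hom_ext (jet_hom_ext _ _ fun b m => ?_)
    exact congrArg₂ (jetMk q E N U.unop)
      (ConcreteCategory.congr_hom (X.presheaf.map_id U) b)
      (ConcreteCategory.congr_hom (E.presheaf.map_id U) m)
  map_comp i j := by
    refine AddCommGrpCat.hom_ext (jet_hom_ext _ _ fun b m => ?_)
    exact congrArg₂ (jetMk q E N _)
      (ConcreteCategory.congr_hom (X.presheaf.map_comp i j) b)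
      (ConcreteCategory.congr_hom (E.presheaf.map_comp i j) m)

instance jetPresheafAbModule (N : ℕ) (U : X.Opensᵒᵖ) :
    Module (X.ringCatSheaf.obj.obj U) ((jetPresheafAb q E N).obj U) :=
  inferInstanceAs (Module Γ(X, U.unop) (JetSections q E N U.unop))

/-- The presheaf of `𝒪_X`-modules `U ↦ J^N(E(U) / (q⁻¹ 𝒪_S)(U))`. -/
def jetPresheaf (N : ℕ) : PresheafOfModules.{u} X.ringCatSheaf.obj :=
  PresheafOfModules.ofPresheaf (jetPresheafAb q E N)
    (fun _ _ i r m => (jetRestriction q E N i.unop).map_smulₛₗ r m)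

/-- The jet sheaf `J^N(E/S)`, the sheaf of `𝒪_X`-modules associated to the presheaf
`U ↦ J^N(E(U) / (q⁻¹ 𝒪_S)(U))`. If `E` is quasi-coherent, its restriction to an affine open
`Spec B` lying over an affine open `Spec A` of `S` is the sheaf associated to
`J^N(M/A)`, where `M = E(Spec B)`. -/
def jetSheaf (N : ℕ) : X.Modules :=
  (PresheafOfModules.sheafification (𝟙 X.ringCatSheaf.obj)).obj (jetPresheaf q E N)

lemma jetMk_add (N : ℕ) (U : X.Opens) (b : Γ(X, U)) (m m' : Γ(E, U)) :
    jetMk q E N U b (m + m') = jetMk q E N U b m + jetMk q E N U b m' := by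
  simp [jetMk, TensorProduct.tmul_add]

/-- The maps `E(U) → J^N(E(U) / (q⁻¹ 𝒪_S)(U))`, `m ↦ [1 ⊗ m]`. -/
def universalDerivationPresheaf (N : ℕ) : E.presheaf ⟶ jetPresheafAb q E N where
  app U := AddCommGrpCat.ofHom (AddMonoidHom.mk' (jetMk q E N U.unop 1) (jetMk_add q E N U.unop 1))
  naturality U V i := by
    ext m
    exact congrArg (fun b => jetMk q E N V.unop b (E.presheaf.map i m))
      (map_one (X.presheaf.map i).hom).symm

/-- The universal derivation `d^N : E ⟶ J^N(E/S)`, a morphism of sheaves of abelian groups. -/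
def universalDerivation (N : ℕ) : (toAb X).obj E ⟶ (toAb X).obj (jetSheaf q E N) :=
  ⟨universalDerivationPresheaf q E N ≫
    CategoryTheory.toSheafify (Opens.grothendieckTopology X) (jetPresheafAb q E N)⟩

/-- The map on sections over `U` of a morphism of the underlying sheaves of abelian groups. -/
def appAb {E₁ E₂ : X.Modules} (D : (toAb X).obj E₁ ⟶ (toAb X).obj E₂) (U : X.Opens) :
    Γ(E₁, U) →+ Γ(E₂, U) :=
  (D.hom.app (op U)).hom

/-- `D : E₁ ⟶ E₂` is a differential operator of order `≤ N` relative to `S`: an `𝒪_S`-linear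
morphism of sheaves that factors as `d^N : E₁ ⟶ J^N(E₁/S)` followed by an `𝒪_X`-linear morphism
`J^N(E₁/S) ⟶ E₂`. -/
structure IsDiffOp (N : ℕ) {E₁ E₂ : X.Modules} (D : (toAb X).obj E₁ ⟶ (toAb X).obj E₂) :
    Prop where
  linear : ∀ (V : S.Opens) (U : X.Opens) (h : U ≤ q ⁻¹ᵁ V) (s : Γ(S, V)) (m : Γ(E₁, U)),
    appAb D U (q.appLE V U h s • m) = q.appLE V U h s • appAb D U m
  exists_factorization : ∃ D' : jetSheaf q E₁ N ⟶ E₂,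
    D = universalDerivation q E₁ N ≫ (toAb X).map D'

end JetSheaf

section Comparison

variable {C C' D D' : Type*} [Category C] [Category C'] [Category D] [Category D']
  [Abelian C] [Abelian C'] [Abelian D] [Abelian D']

section Lift

variable (F : C ⥤ D) [F.Additive] [PreservesFiniteLimits F] [PreservesFiniteColimits F]
  {Z : C} (I : InjectiveResolution Z) (J : InjectiveResolution (F.obj Z))

/-- The augmentation `Z ⟶ I⁰` of an injective resolution `I` of `Z`. -/
def augmentation {A : Type*} [Category A] [Abelian A] {Z : A} (I : InjectiveResolution Z) :
    Z ⟶ I.cocomplex.X 0 :=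
  I.ι.f 0

instance augmentation_mono {A : Type*} [Category A] [Abelian A] {Z : A}
    (I : InjectiveResolution Z) : Mono (augmentation I) :=
  inferInstanceAs (Mono (I.ι.f 0))

lemma augmentation_d {A : Type*} [Category A] [Abelian A] {Z : A} (I : InjectiveResolution Z) :
    augmentation I ≫ I.cocomplex.d 0 1 = 0 :=
  I.ι_f_zero_comp_complex_d

/-- Degree `0` of `liftResolution`. -/
def liftZero : F.obj (I.cocomplex.X 0) ⟶ J.cocomplex.X 0 :=
  Injective.factorThru (augmentation J) (F.map (augmentation I))

lemma map_augmentation_liftZero :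
    F.map (augmentation I) ≫ liftZero F I J = augmentation J :=
  Injective.comp_factorThru _ _

/-- Degree `1` of `liftResolution`. -/
def liftOne : F.obj (I.cocomplex.X 1) ⟶ J.cocomplex.X 1 :=
  (I.exact₀.map F).descToInjective (liftZero F I J ≫ J.cocomplex.d 0 1) (by
    change F.map (augmentation I) ≫ liftZero F I J ≫ J.cocomplex.d 0 1 = 0
    rw [← Category.assoc, map_augmentation_liftZero, augmentation_d])

lemma d_liftOne : F.map (I.cocomplex.d 0 1) ≫ liftOne F I J =
    liftZero F I J ≫ J.cocomplex.d 0 1 :=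
  (I.exact₀.map F).comp_descToInjective _ _

/-- The inductive step of `liftResolution`. -/
def liftSucc (n : ℕ) (g : F.obj (I.cocomplex.X n) ⟶ J.cocomplex.X n)
    (g' : F.obj (I.cocomplex.X (n + 1)) ⟶ J.cocomplex.X (n + 1))
    (w : F.map (I.cocomplex.d n (n + 1)) ≫ g' = g ≫ J.cocomplex.d n (n + 1)) :
    Σ' g'' : F.obj (I.cocomplex.X (n + 2)) ⟶ J.cocomplex.X (n + 2),
      F.map (I.cocomplex.d (n + 1) (n + 2)) ≫ g'' = g' ≫ J.cocomplex.d (n + 1) (n + 2) :=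
  ⟨((I.exact_succ n).map F).descToInjective (g' ≫ J.cocomplex.d (n + 1) (n + 2)) (by
      change F.map (I.cocomplex.d n (n + 1)) ≫ g' ≫ J.cocomplex.d (n + 1) (n + 2) = 0
      rw [← Category.assoc, w, Category.assoc, J.cocomplex.d_comp_d, comp_zero]),
    ((I.exact_succ n).map F).comp_descToInjective _ _⟩

/-- Given an exact functor `F`, an injective resolution `I` of `Z` and an injective resolution `J`
of `F Z`, a morphism of complexes `F I ⟶ J` which extends the identity of `F Z`. Such a morphism is
unique up to homotopy. -/
def liftResolution : (F.mapHomologicalComplex (ComplexShape.up ℕ)).obj I.cocomplex ⟶ J.cocomplex :=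
  CochainComplex.mkHom _ _ (liftZero F I J) (liftOne F I J) (d_liftOne F I J).symm
    fun n ⟨g, g', w⟩ => ⟨(liftSucc F I J n g g' w.symm).1, (liftSucc F I J n g g' w.symm).2.symm⟩

lemma map_augmentation_liftResolution :
    F.map (augmentation I) ≫ (liftResolution F I J).f 0 = augmentation J :=
  map_augmentation_liftZero F I J

end Lift

variable {F : C ⥤ D} [F.Additive] [PreservesFiniteLimits F] [PreservesFiniteColimits F]
  {G : C ⥤ C'} [G.Additive] {G' : D ⥤ D'} [G'.Additive]
  {F' : C' ⥤ D'} [F'.Additive] [PreservesFiniteLimits F'] [PreservesFiniteColimits F']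

/-- The isomorphism of complexes `F' G K ≅ G' F K` deduced from `G ⋙ F' ≅ F ⋙ G'`. -/
def mapComplexIso (e : G ⋙ F' ≅ F ⋙ G') (K : CochainComplex C ℕ) :
    (F'.mapHomologicalComplex (ComplexShape.up ℕ)).obj
        ((G.mapHomologicalComplex (ComplexShape.up ℕ)).obj K) ≅
      (G'.mapHomologicalComplex (ComplexShape.up ℕ)).obj
        ((F.mapHomologicalComplex (ComplexShape.up ℕ)).obj K) :=
  HomologicalComplex.Hom.isoOfComponents (fun n => e.app (K.X n))
    (fun i j _ => (e.hom.naturality (K.d i j)).symm)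

/-- Given exact functors `F`, `F'` and an isomorphism `F' G ≅ G' F`, the canonical comparison
morphism `F' ((R^i G) Z) ⟶ (R^i G') (F Z)`: if `I` is an injective resolution of `Z` and `J` is an
injective resolution of `F Z`, it is
`F' (H^i (G I)) ≅ H^i (F' G I) ≅ H^i (G' F I) ⟶ H^i (G' J)`,
where the last arrow is induced by a morphism `F I ⟶ J` that extends the identity of `F Z`. -/
def derivedComparison [HasInjectiveResolutions C] [HasInjectiveResolutions D]
    (e : G ⋙ F' ≅ F ⋙ G') (i : ℕ) (Z : C) :
    F'.obj ((G.rightDerived i).obj Z) ⟶ (G'.rightDerived i).obj (F.obj Z) :=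
  let I := injectiveResolution Z
  let J := injectiveResolution (F.obj Z)
  F'.map (I.isoRightDerivedObj G i).hom ≫
    ((((G.mapHomologicalComplex (ComplexShape.up ℕ)).obj I.cocomplex).sc i).mapHomologyIso F').inv ≫
    HomologicalComplex.homologyMap (mapComplexIso e I.cocomplex).hom i ≫
    HomologicalComplex.homologyMap
      ((G'.mapHomologicalComplex (ComplexShape.up ℕ)).map (liftResolution F I J)) i ≫
    (J.isoRightDerivedObj G' i).inv

end Comparison

section HigherDirectImage

variable {X S : Scheme.{u}} (q : X ⟶ S)

/-- The higher direct image `R^i q_* E`, as a sheaf of `𝒪_S`-modules: the `i`-th right derived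
functor of `q_* : Mod(𝒪_X) ⥤ Mod(𝒪_S)`. -/
def higherDirectImage (i : ℕ) : X.Modules ⥤ S.Modules :=
  (Scheme.Modules.pushforward q).rightDerived i

instance additive_pushforward : (TopCat.Sheaf.pushforward AddCommGrpCat.{u} q.base).Additive where

/-- The `i`-th right derived functor of `q_*` on sheaves of abelian groups. -/
def higherDirectImageAb (i : ℕ) :
    TopCat.Sheaf AddCommGrpCat.{u} X ⥤ TopCat.Sheaf AddCommGrpCat.{u} S :=
  (TopCat.Sheaf.pushforward AddCommGrpCat.{u} q.base).rightDerived i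

/-- The canonical morphism from the abelian sheaf underlying `R^i q_* E` to the `i`-th higher
direct image of the abelian sheaf underlying `E`. -/
def higherDirectImageComparison (i : ℕ) (E : X.Modules) :
    (toAb S).obj ((higherDirectImage q i).obj E) ⟶
      (higherDirectImageAb q i).obj ((toAb X).obj E) :=
  derivedComparison (F := toAb X) (F' := toAb S) (G := Scheme.Modules.pushforward q)
    (G' := TopCat.Sheaf.pushforward AddCommGrpCat.{u} q.base) (Iso.refl _) i E

/-- The `𝒪_S`-linear morphism `f : R^i q_* E₁ ⟶ R^i q_* E₂` is induced by the morphism of abelian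
sheaves `D : E₁ ⟶ E₂`: under the canonical comparison morphisms, the morphism of abelian sheaves
underlying `f` is the image of `D` under the `i`-th right derived functor of `q_*` on abelian
sheaves. -/
def IsInducedBy (i : ℕ) {E₁ E₂ : X.Modules} (D : (toAb X).obj E₁ ⟶ (toAb X).obj E₂)
    (f : (higherDirectImage q i).obj E₁ ⟶ (higherDirectImage q i).obj E₂) : Prop :=
  (toAb S).map f ≫ higherDirectImageComparison q i E₂ =
    higherDirectImageComparison q i E₁ ≫ (higherDirectImageAb q i).map D

end HigherDirectImage

end RelDiffOp

end

/-! `D` is not `𝒪_X`-linear, so functoriality of `R^i q_*` on `𝒪_X`-modules says nothing about it.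
But the tensor product defining the jets is taken over `q⁻¹ 𝒪_S`, so `m ↦ [1 ⊗ m]`, and with it `D`,
is `q⁻¹ 𝒪_S`-linear (`IsDiffOp.map_smul`). The direct image of modules factors through `q⁻¹
𝒪_S`-modules (`pushforwardIso`), and there `D` is a morphism.

It remains to compare derived direct images for `𝒪_X`-modules, `q⁻¹ 𝒪_S`-modules and abelian
sheaves. In all three categories injectives are flasque as abelian sheaves. Flasque sheaves are
adapted to `q_*` (`isAdapted_flasque`), so `q_*` preserves quasi-isomorphisms between complexes of
flasque sheaves concentrated in degrees `≥ 0` (`IsAdapted.quasiIso_map`). Hence the comparison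
morphisms are isomorphisms (`isIso_derivedComparison`); as forgetting the `𝒪_S`-action is faithful,
uniqueness follows.

For existence (`existsUnique_rightDerived_map`), resolve `E₁`, `E₂` by injective `𝒪_X`-modules `I₁`,
`I₂`, and `E₂` by injective `q⁻¹ 𝒪_S`-modules `K₂`. There are maps `a : I₁ ⟶ K₂` over `D` and `b :
I₂ ⟶ K₂` over the identity; `q_* b` is a quasi-isomorphism, and `R^i D` is `H^i(q_* a)` followed by
the inverse of `H^i(q_* b)`. It induces the right map on abelian sheaves because maps into an
injective resolution are determined up to homotopy by the augmentation (`homologyMap_map_eq`). -/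

noncomputable section

namespace RelDiffOp

/-! ### Adapted classes of objects and quasi-isomorphisms. -/

section Adapted

variable {D D' : Type*} [Category D] [Category D'] [Abelian D] [Abelian D']

lemma quasiIso_iff_acyclic_mappingCone {K L : CochainComplex D ℤ} (φ : K ⟶ L) :
    QuasiIso φ ↔ (CochainComplex.mappingCone φ).Acyclic := by
  rw [← HomotopyCategory.quotient_obj_mem_subcategoryAcyclic_iff_acyclic,
    ← HomologicalComplex.mem_quasiIso_iff, ← HomotopyCategory.quotient_map_mem_quasiIso_iff,
    HomotopyCategory.quasiIso_eq_trW_subcategoryAcyclic]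
  exact (HomotopyCategory.subcategoryAcyclic D).trW_iff_of_distinguished _
    (HomotopyCategory.mappingCone_triangleh_distinguished φ)

/-- A class of objects `P` is adapted to a functor `G` if it is closed under finite direct sums and
cokernels of monomorphisms, and if `G` preserves the exactness of short exact sequences
whose first term belongs to `P`. -/
structure IsAdapted (G : D ⥤ D') [G.Additive] (P : ObjectProperty D) : Prop where
  of_iso {X Y : D} (e : X ≅ Y) (h : P X) : P Y
  of_isZero {X : D} (h : IsZero X) : P X
  biprod {X Y : D} (hX : P X) (hY : P Y) : P (X ⊞ Y)
  of_shortExact {S : ShortComplex D} (hS : S.ShortExact) (h₁ : P S.X₁) (h₂ : P S.X₂) : P S.X₃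
  map_shortExact {S : ShortComplex D} (hS : S.ShortExact) (h₁ : P S.X₁) : (S.map G).ShortExact

/-- Exactness depends only on the image of the first map and the kernel of the second. Used to
splice the short exact sequences of cycles back into a complex. -/
lemma exact_of_epi_of_mono {A X Y Z B : D} {f : X ⟶ Y} {g : Y ⟶ Z} {w : f ≫ g = 0}
    (h : (ShortComplex.mk f g w).Exact) {c : A ⟶ Y} {d : Y ⟶ B} (w' : c ≫ d = 0)
    (a : A ⟶ X) (b : Z ⟶ B) (_ : Epi a) (_ : Mono b) (ha : a ≫ f = c) (hb : g ≫ b = d) :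
    (ShortComplex.mk c d w').Exact := by
  subst ha hb
  let φ : ShortComplex.mk (a ≫ f) g (by rw [Category.assoc, w, comp_zero]) ⟶
    ShortComplex.mk f g w := { τ₁ := a, τ₂ := 𝟙 _, τ₃ := 𝟙 _ }
  let ψ : ShortComplex.mk (a ≫ f) g (by rw [Category.assoc, w, comp_zero]) ⟶
      ShortComplex.mk (a ≫ f) (g ≫ b) w' := { τ₁ := 𝟙 _, τ₂ := 𝟙 _, τ₃ := b }
  have : Epi φ.τ₁ := ‹Epi a›
  have : Mono ψ.τ₃ := ‹Mono b›
  have : IsIso φ.τ₂ := inferInstanceAs (IsIso (𝟙 _))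
  have : IsIso ψ.τ₂ := inferInstanceAs (IsIso (𝟙 _))
  have : Mono φ.τ₃ := inferInstanceAs (Mono (𝟙 _))
  have : Epi ψ.τ₁ := inferInstanceAs (Epi (𝟙 _))
  exact (ShortComplex.exact_iff_of_epi_of_isIso_of_mono ψ).1
    ((ShortComplex.exact_iff_of_epi_of_isIso_of_mono φ).2 h)

lemma shortExact_cycles {K : CochainComplex D ℤ} (hK : K.Acyclic) (n m : ℤ) (h : n + 1 = m) :
    (ShortComplex.mk (K.iCycles n) (K.toCycles n m) (by
      rw [← cancel_mono (K.iCycles m), Category.assoc, K.toCycles_i, K.iCycles_d,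
        zero_comp])).ShortExact where
  exact := by
    have h₁ : (ShortComplex.mk (K.iCycles n) (K.d n m) (K.iCycles_d n m)).Exact :=
      ShortComplex.exact_of_f_is_kernel _ (K.cyclesIsKernel n m (by simpa using h))
    refine (ShortComplex.exact_iff_of_epi_of_isIso_of_mono
      (S₁ := ShortComplex.mk (K.iCycles n) (K.toCycles n m) _)
      (S₂ := ShortComplex.mk (K.iCycles n) (K.d n m) (K.iCycles_d n m))
      { τ₁ := 𝟙 _, τ₂ := 𝟙 _, τ₃ := K.iCycles m }).2 h₁
  mono_f := by dsimp; infer_instance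
  -- Only this part uses acyclicity: the cokernel of `toCycles` is the homology in degree `m`.
  epi_g := by
    have h₁ := K.homologyIsCokernel n m (by simp [← h])
    exact Preadditive.epi_of_isZero_cokernel' _ h₁ ((K.exactAt_iff_isZero_homology m).1 (hK m))

namespace IsAdapted

variable {G : D ⥤ D'} [G.Additive] {P : ObjectProperty D} (hP : IsAdapted G P)

include hP

/-- Induction along `0 → Zⁿ → Kⁿ → Zⁿ⁺¹ → 0`: each step is a cokernel of a monomorphism between
objects of `P`. Boundedness below starts the induction, with `Zⁿ = 0` for `n < n₀`. -/
lemma prop_cycles {K : CochainComplex D ℤ} (hK : K.Acyclic) (n₀ : ℤ)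
    (h₀ : ∀ i < n₀, IsZero (K.X i)) (hX : ∀ i, P (K.X i)) (n : ℤ) : P (K.cycles n) := by
  have h₁ (n : ℤ) (hn : n < n₀) : P (K.cycles n) :=
    hP.of_isZero ((h₀ n hn).of_mono (K.iCycles n))
  obtain hn | hn := lt_or_ge n (n₀ - 1)
  · exact h₁ n (by lia)
  · induction n, hn using Int.leInduction with
    | base => exact h₁ _ (by lia)
    | succ n hn ih => exact hP.of_shortExact (shortExact_cycles hK n _ rfl) ih (hX n)

lemma map_acyclic {K : CochainComplex D ℤ} (hK : K.Acyclic) (n₀ : ℤ)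
    (h₀ : ∀ i < n₀, IsZero (K.X i)) (hX : ∀ i, P (K.X i)) :
    ((G.mapHomologicalComplex (ComplexShape.up ℤ)).obj K).Acyclic := by
  -- `G` keeps the sequences of cycles short exact because their first terms lie in `P`; the
  -- differentials of `G K` factor through the `G(Zⁿ)`, so the sequences splice.
  have key (n m : ℤ) (h : n + 1 = m) :=
    hP.map_shortExact (shortExact_cycles hK n m h) (hP.prop_cycles hK n₀ h₀ hX n)
  intro n
  rw [HomologicalComplex.exactAt_iff' _ (n - 1) n (n + 1) (by simp) (by simp)]
  have e₁ : Epi (G.map (K.toCycles (n - 1) n)) := (key (n - 1) n (by simp)).epi_g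
  have e₂ : Mono (G.map (K.iCycles (n + 1))) := (key (n + 1) _ rfl).mono_f
  exact exact_of_epi_of_mono (key n _ rfl).exact _ _ _ e₁ e₂
    ((G.map_comp _ _).symm.trans (congrArg G.map (K.toCycles_i _ _)))
    ((G.map_comp _ _).symm.trans (congrArg G.map (K.toCycles_i _ _)))

/-- The mapping cone of `φ` is an acyclic, bounded below complex with terms in `P`, and an additive
functor commutes with mapping cones. -/
lemma quasiIso_map_int {K L : CochainComplex D ℤ} (φ : K ⟶ L) [QuasiIso φ] (n₀ : ℤ)
    (hK₀ : ∀ i < n₀, IsZero (K.X i)) (hL₀ : ∀ i < n₀, IsZero (L.X i))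
    (hK : ∀ i, P (K.X i)) (hL : ∀ i, P (L.X i)) :
    QuasiIso ((G.mapHomologicalComplex (ComplexShape.up ℤ)).map φ) := by
  let e (n : ℤ) : (CochainComplex.mappingCone φ).X n ≅ K.X (n + 1) ⊞ L.X n :=
    HomologicalComplex.homotopyCofiber.XIsoBiprod φ n (n + 1) rfl
  rw [quasiIso_iff_acyclic_mappingCone]
  -- The bound drops by one since the cone has `K.X (i + 1)` in degree `i`.
  have := hP.map_acyclic ((quasiIso_iff_acyclic_mappingCone φ).1 inferInstance) (n₀ - 1)
    (fun i hi ↦ ((biprod_isZero_iff _ _).2 ⟨hK₀ _ (by lia), hL₀ _ (by lia)⟩).of_iso (e i))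
    (fun i ↦ hP.of_iso (e i).symm (hP.biprod (hK _) (hL _)))
  intro n
  exact (this n).of_iso (CochainComplex.mappingCone.mapHomologicalComplexIso φ G)

end IsAdapted

/-- The extension by zero of complexes commutes with additive functors, in each degree. -/
def mapExtendXIso (G : D ⥤ D') [G.Additive] (K : CochainComplex D ℕ) :
    ∀ o : Option ℕ, G.obj (HomologicalComplex.extend.X K o) ≅
      HomologicalComplex.extend.X ((G.mapHomologicalComplex (ComplexShape.up ℕ)).obj K) o
  | some _ => Iso.refl _
  | none => (G.map_isZero (isZero_zero D)).iso (isZero_zero D')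

lemma mapExtendXIso_hom_d (G : D ⥤ D') [G.Additive] (K : CochainComplex D ℕ) :
    ∀ o o' : Option ℕ, (mapExtendXIso G K o).hom ≫ HomologicalComplex.extend.d _ o o' =
      G.map (HomologicalComplex.extend.d K o o') ≫ (mapExtendXIso G K o').hom
  | some _, some _ => (Category.id_comp _).trans (Category.comp_id _).symm
  | none, _ => (G.map_isZero (isZero_zero D)).eq_of_src _ _
  | some _, none => (isZero_zero D').eq_of_tgt _ _

lemma mapExtendXIso_hom_mapX (G : D ⥤ D') [G.Additive] {K L : CochainComplex D ℕ} (φ : K ⟶ L) :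
    ∀ o : Option ℕ, G.map (HomologicalComplex.extend.mapX φ o) ≫ (mapExtendXIso G L o).hom =
      (mapExtendXIso G K o).hom ≫ HomologicalComplex.extend.mapX
        ((G.mapHomologicalComplex (ComplexShape.up ℕ)).map φ) o
  | some _ => (Category.comp_id _).trans (Category.id_comp _).symm
  | none => (isZero_zero D').eq_of_tgt _ _

/-- The extension by zero of complexes commutes with additive functors. -/
def mapExtendIso (G : D ⥤ D') [G.Additive] (K : CochainComplex D ℕ) :
    (G.mapHomologicalComplex (ComplexShape.up ℤ)).obj (K.extend ComplexShape.embeddingUpNat) ≅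
      ((G.mapHomologicalComplex (ComplexShape.up ℕ)).obj K).extend ComplexShape.embeddingUpNat :=
  HomologicalComplex.Hom.isoOfComponents (fun _ ↦ mapExtendXIso G K _)
    (fun _ _ _ ↦ mapExtendXIso_hom_d G K _ _)

/-- A functor `G` sends a quasi-isomorphism between complexes of objects in a class adapted to `G`
to a quasi-isomorphism. -/
lemma IsAdapted.quasiIso_map {G : D ⥤ D'} [G.Additive] {P : ObjectProperty D}
    (hP : IsAdapted G P) {K L : CochainComplex D ℕ} (φ : K ⟶ L) [QuasiIso φ]
    (hK : ∀ i, P (K.X i)) (hL : ∀ i, P (L.X i)) :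
    QuasiIso ((G.mapHomologicalComplex (ComplexShape.up ℕ)).map φ) := by
  rw [← HomologicalComplex.quasiIso_extendMap_iff _ ComplexShape.embeddingUpNat]
  have h₀ (K : CochainComplex D ℕ) (i : ℤ) (hi : i < 0) :
      IsZero ((K.extend ComplexShape.embeddingUpNat).X i) :=
    K.isZero_extend_X _ _ (fun j (hj : (j : ℤ) = i) ↦ by lia)
  have h₁ (K : CochainComplex D ℕ) (hK : ∀ i, P (K.X i)) (i : ℤ) :
      P ((K.extend ComplexShape.embeddingUpNat).X i) := by
    obtain hi | ⟨j, rfl⟩ := lt_or_ge i 0 |>.imp_right Int.eq_ofNat_of_zero_le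
    · exact hP.of_isZero (h₀ K i hi)
    · exact hP.of_iso (K.extendXIso ComplexShape.embeddingUpNat (i := j) rfl).symm (hK j)
  have h₂ := hP.quasiIso_map_int (HomologicalComplex.extendMap φ ComplexShape.embeddingUpNat) 0
    (h₀ K) (h₀ L) (h₁ K hK) (h₁ L hL)
  refine (quasiIso_iff_of_arrow_mk_iso _ _
    (Arrow.isoMk (mapExtendIso G K) (mapExtendIso G L) ?_)).1 h₂
  ext i
  exact (mapExtendXIso_hom_mapX G φ _).symm

end Adapted

/-! ### Maps into complexes of injectives, up to homotopy. -/

section LiftUniqueness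

section

variable {D : Type*} [Category D] [Abelian D] {K L : CochainComplex D ℕ} [∀ n, Injective (L.X n)]

/-- A morphism from an exact complex to a complex of injective objects is homotopic to zero if
it vanishes on the augmentation. -/
lemma nonempty_homotopy_zero {A : D} {ε : A ⟶ K.X 0} {w : ε ≫ K.d 0 1 = 0}
    (hε : (ShortComplex.mk ε (K.d 0 1) w).Exact)
    (hK : ∀ n, (ShortComplex.mk (K.d n (n + 1)) (K.d (n + 1) (n + 2)) (K.d_comp_d _ _ _)).Exact)
    (f : K ⟶ L) (hf : ε ≫ f.f 0 = 0) : Nonempty (Homotopy f 0) := by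
  obtain ⟨z, hz⟩ : ∃ z : K.X 1 ⟶ L.X 0, f.f 0 = K.d 0 1 ≫ z :=
    ⟨hε.descToInjective _ hf, (hε.comp_descToInjective _ _).symm⟩
  have succ (n : ℕ) (g : K.X (n + 1) ⟶ L.X (n + 1))
      (hg : K.d n (n + 1) ≫ g = 0) : ∃ s : K.X (n + 2) ⟶ L.X (n + 1), K.d (n + 1) (n + 2) ≫ s = g :=
    ⟨(hK n).descToInjective _ hg, (hK n).comp_descToInjective _ _⟩
  obtain ⟨o, ho⟩ := succ 0 (f.f 1 - z ≫ L.d 0 1) (by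
    rw [Preadditive.comp_sub, ← reassoc_of% hz, ← f.comm, sub_self])
  have step (n : ℕ) (g : K.X (n + 1) ⟶ L.X n) (g' : K.X (n + 2) ⟶ L.X (n + 1))
      (h : f.f (n + 1) = g ≫ L.d n (n + 1) + K.d (n + 1) (n + 2) ≫ g') :
      ∃ g'' : K.X (n + 3) ⟶ L.X (n + 2),
        f.f (n + 2) = g' ≫ L.d (n + 1) (n + 2) + K.d (n + 2) (n + 3) ≫ g'' := by
    -- The homotopy relation one degree lower shows that this defect vanishes on boundaries, so by
    -- exactness and injectivity it factors through the next differential.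
    obtain ⟨s, hs⟩ := succ (n + 1) (f.f (n + 2) - g' ≫ L.d (n + 1) (n + 2)) (by
      rw [Preadditive.comp_sub, ← f.comm, h, Preadditive.add_comp]
      simp)
    exact ⟨s, by rw [hs, add_sub_cancel]⟩
  exact ⟨Homotopy.mkCoinductive f z hz o (by rw [ho, add_sub_cancel])
    fun n p => ⟨(step n p.1 p.2.1 p.2.2).choose, (step n p.1 p.2.1 p.2.2).choose_spec⟩⟩

end

variable {C D : Type*} [Category C] [Category D] [Abelian C] [Abelian D]
  (F : C ⥤ D) [F.Additive] [PreservesFiniteLimits F] [PreservesFiniteColimits F]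
  {Z : C} (I : InjectiveResolution Z)

/-- Two out of three: the lift composed with `F(Z → I)` is `Z → J` up to the canonical
identification, and exactness of `F` makes `F(Z → I)` a quasi-isomorphism. -/
lemma quasiIso_liftResolution (J : InjectiveResolution (F.obj Z)) :
    QuasiIso (liftResolution F I J) := by
  have h : (HomologicalComplex.singleMapHomologicalComplex F (ComplexShape.up ℕ) 0).inv.app Z ≫
      (F.mapHomologicalComplex (ComplexShape.up ℕ)).map I.ι ≫ liftResolution F I J = J.ι := by
    apply HomologicalComplex.from_single_hom_ext
    refine Eq.trans ?_ (map_augmentation_liftResolution F I J)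
    rw [HomologicalComplex.comp_f,
      HomologicalComplex.singleMapHomologicalComplex_inv_app_self]
    refine (congrArg (fun φ => φ ≫ F.map (augmentation I) ≫ (liftResolution F I J).f 0)
      ((Category.id_comp _).trans (F.map_id (((CochainComplex.single₀ C).obj Z).X 0)))).trans ?_
    exact Category.id_comp _
  have h₁ : QuasiIso ((F.mapHomologicalComplex (ComplexShape.up ℕ)).map I.ι ≫
      liftResolution F I J) := by
    rw [← quasiIso_iff_comp_left
      ((HomologicalComplex.singleMapHomologicalComplex F (ComplexShape.up ℕ) 0).inv.app Z), h]
    infer_instance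
  exact quasiIso_of_comp_left ((F.mapHomologicalComplex (ComplexShape.up ℕ)).map I.ι) _

variable {F I} {L : CochainComplex D ℕ} [∀ n, Injective (L.X n)]

/-- If `F` is an exact functor and `I` is an injective resolution of `Z`, two morphisms from `F I`
to a complex of injective objects which agree on `F Z` induce the same morphisms in homology, after
the application of any additive functor. -/
lemma homologyMap_map_eq {D' : Type*} [Category D'] [Abelian D'] (G : D ⥤ D') [G.Additive]
    (f g : (F.mapHomologicalComplex (ComplexShape.up ℕ)).obj I.cocomplex ⟶ L)
    (h : F.map (augmentation I) ≫ f.f 0 = F.map (augmentation I) ≫ g.f 0) (i : ℕ) :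
    HomologicalComplex.homologyMap ((G.mapHomologicalComplex (ComplexShape.up ℕ)).map f) i =
      HomologicalComplex.homologyMap ((G.mapHomologicalComplex (ComplexShape.up ℕ)).map g) i := by
  obtain ⟨H⟩ := nonempty_homotopy_zero (I.exact₀.map F) (fun n => (I.exact_succ n).map F) (f - g)
    (by
      exact (Preadditive.comp_sub _ _ _).trans (sub_eq_zero.2 h))
  exact (G.mapHomotopy (Homotopy.equivSubZero.symm H)).homologyMap_eq i

end LiftUniqueness

/-! ### The comparison morphism between derived functors. -/

section Comparison

variable {C C' D D' : Type*} [Category C] [Category C'] [Category D] [Category D']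
  [Abelian C] [Abelian C'] [Abelian D] [Abelian D']
  {F : C ⥤ D} [F.Additive]
  {G : C ⥤ C'} [G.Additive] {G' : D ⥤ D'} [G'.Additive]
  {F' : C' ⥤ D'} [F'.Additive] [PreservesFiniteLimits F'] [PreservesFiniteColimits F']

/-- Exact functors commute with homology. -/
def mapHomologyIso (F' : C' ⥤ D') [F'.Additive] [PreservesFiniteLimits F']
    [PreservesFiniteColimits F'] (i : ℕ) (K : CochainComplex C' ℕ) :
    F'.obj (K.homology i) ≅ ((F'.mapHomologicalComplex (ComplexShape.up ℕ)).obj K).homology i :=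
  ((K.sc i).mapHomologyIso F').symm

lemma mapHomologyIso_hom_naturality (i : ℕ) {K L : CochainComplex C' ℕ} (φ : K ⟶ L) :
    F'.map (HomologicalComplex.homologyMap φ i) ≫ (mapHomologyIso F' i L).hom =
      (mapHomologyIso F' i K).hom ≫ HomologicalComplex.homologyMap
        ((F'.mapHomologicalComplex (ComplexShape.up ℕ)).map φ) i :=
  ShortComplex.mapHomologyIso_inv_naturality
    ((HomologicalComplex.shortComplexFunctor C' _ i).map φ) F'

variable (e : G ⋙ F' ≅ F ⋙ G')

/-- The isomorphism `F' (H^i (G K)) ≅ H^i (G' F K)` for an exact functor `F'` and an isomorphism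
`G ⋙ F' ≅ F ⋙ G'`. -/
def mapHomologyComplexIso (i : ℕ) (K : CochainComplex C ℕ) :
    F'.obj (((G.mapHomologicalComplex (ComplexShape.up ℕ)).obj K).homology i) ≅
      ((G'.mapHomologicalComplex (ComplexShape.up ℕ)).obj
        ((F.mapHomologicalComplex (ComplexShape.up ℕ)).obj K)).homology i :=
  mapHomologyIso F' i _ ≪≫ (HomologicalComplex.homologyFunctor D' _ i).mapIso (mapComplexIso e K)

lemma mapHomologyComplexIso_hom (i : ℕ) (K : CochainComplex C ℕ) :
    (mapHomologyComplexIso e i K).hom = (mapHomologyIso F' i _).hom ≫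
      HomologicalComplex.homologyMap (mapComplexIso e K).hom i :=
  rfl

lemma mapHomologyComplexIso_hom_naturality (i : ℕ) {K L : CochainComplex C ℕ} (φ : K ⟶ L) :
    F'.map (HomologicalComplex.homologyMap
        ((G.mapHomologicalComplex (ComplexShape.up ℕ)).map φ) i) ≫
        (mapHomologyComplexIso e i L).hom =
      (mapHomologyComplexIso e i K).hom ≫ HomologicalComplex.homologyMap
        ((G'.mapHomologicalComplex (ComplexShape.up ℕ)).map
          ((F.mapHomologicalComplex (ComplexShape.up ℕ)).map φ)) i := by
  have h : (F'.mapHomologicalComplex (ComplexShape.up ℕ)).map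
      ((G.mapHomologicalComplex (ComplexShape.up ℕ)).map φ) ≫ (mapComplexIso e L).hom =
      (mapComplexIso e K).hom ≫ (G'.mapHomologicalComplex (ComplexShape.up ℕ)).map
          ((F.mapHomologicalComplex (ComplexShape.up ℕ)).map φ) := by
    ext n
    exact e.hom.naturality (φ.f n)
  rw [mapHomologyComplexIso_hom, mapHomologyComplexIso_hom, ← Category.assoc,
    mapHomologyIso_hom_naturality, Category.assoc, Category.assoc,
    ← HomologicalComplex.homologyMap_comp, ← HomologicalComplex.homologyMap_comp, h]

/-- A faithful exact functor reflects quasi-isomorphisms, so they can be tested on underlying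
abelian sheaves. -/
lemma quasiIso_iff_of_iso (e : G ⋙ F' ≅ F ⋙ G') [F'.Faithful] {K L : CochainComplex C ℕ} (φ : K ⟶ L) :
    QuasiIso ((G.mapHomologicalComplex (ComplexShape.up ℕ)).map φ) ↔
      QuasiIso ((G'.mapHomologicalComplex (ComplexShape.up ℕ)).map
          ((F.mapHomologicalComplex (ComplexShape.up ℕ)).map φ)) := by
  rw [← HomologicalComplex.quasiIso_map_iff_of_preservesHomology _ F']
  refine quasiIso_iff_of_arrow_mk_iso _ _
    (Arrow.isoMk (mapComplexIso e K) (mapComplexIso e L) ?_)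
  ext n
  exact (e.hom.naturality (φ.f n)).symm

variable [PreservesFiniteLimits F] [PreservesFiniteColimits F]
  [HasInjectiveResolutions C] [HasInjectiveResolutions D]

/-- The right derived functors of `G`, computed with the chosen injective resolution. -/
def rightDerivedIso (G : C ⥤ C') [G.Additive] (i : ℕ) (Z : C) :
    (G.rightDerived i).obj Z ≅ ((G.mapHomologicalComplex (ComplexShape.up ℕ)).obj
      (injectiveResolution Z).cocomplex).homology i :=
  (injectiveResolution Z).isoRightDerivedObj G i

lemma rightDerivedIso_inv_naturality (G : C ⥤ C') [G.Additive] (i : ℕ) {Y Z : C} (f : Y ⟶ Z) :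
    (rightDerivedIso G i Y).inv ≫ (G.rightDerived i).map f =
      HomologicalComplex.homologyMap ((G.mapHomologicalComplex (ComplexShape.up ℕ)).map
        (InjectiveResolution.desc f (injectiveResolution Z) (injectiveResolution Y))) i ≫
        (rightDerivedIso G i Z).inv :=
  InjectiveResolution.isoRightDerivedObj_inv_naturality f _ _ _
    (InjectiveResolution.desc_commutes_zero f _ _) G i

lemma derivedComparison_eq (i : ℕ) (Z : C) :
    derivedComparison e i Z =
      F'.map (rightDerivedIso G i Z).hom ≫
        (mapHomologyComplexIso e i (injectiveResolution Z).cocomplex).hom ≫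
          HomologicalComplex.homologyMap ((G'.mapHomologicalComplex (ComplexShape.up ℕ)).map
            (liftResolution F (injectiveResolution Z) (injectiveResolution (F.obj Z)))) i ≫
          (rightDerivedIso G' i (F.obj Z)).inv := by
  rw [mapHomologyComplexIso_hom, Category.assoc]
  rfl

/-- The comparison morphism is an isomorphism if injective objects are sent to objects of a class
adapted to `G'`. -/
lemma isIso_derivedComparison {P : ObjectProperty D} (hP : IsAdapted G' P)
    (hC : ∀ X : C, Injective X → P (F.obj X)) (hD : ∀ X : D, Injective X → P X) (i : ℕ) (Z : C) :
    IsIso (derivedComparison e i Z) := by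
  have := quasiIso_liftResolution F (injectiveResolution Z) (injectiveResolution (F.obj Z))
  have := hP.quasiIso_map (liftResolution F (injectiveResolution Z)
    (injectiveResolution (F.obj Z))) (fun _ => hC _ inferInstance) (fun _ => hD _ inferInstance)
  have : IsIso (HomologicalComplex.homologyMap ((G'.mapHomologicalComplex (ComplexShape.up ℕ)).map
    (liftResolution F (injectiveResolution Z) (injectiveResolution (F.obj Z)))) i) := inferInstance
  rw [derivedComparison_eq]
  infer_instance

end Comparison

/-! ### The induced morphism on derived functors. -/

section Main

/-- The final diagram chase, with arbitrary objects in place of the homology objects. The witness is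
`α` followed by the inverse of `β`, conjugated by the identifications `r` and `x`. -/
lemma exists_map_comp_eq {C' D' : Type*} [Category C'] [Category D'] {F' : C' ⥤ D'}
    {A₁ A₂ B₁ B₂ X₁ X₂ Y : C'} {U₁ U₂ V V₁ V₂ W₁ W₂ : D'}
    (r₁ : A₁ ≅ B₁) (r₂ : A₂ ≅ B₂) (x₁ : B₁ ≅ X₁) (x₂ : B₂ ≅ X₂) (α : X₁ ⟶ Y) (β : X₂ ⟶ Y) (_ : IsIso β)
    (w₁ : F'.obj X₁ ≅ U₁) (w₂ : F'.obj X₂ ≅ U₂) (w : F'.obj Y ≅ V) {α' : U₁ ⟶ V} {β' : U₂ ⟶ V}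
    (hα : F'.map α ≫ w.hom = w₁.hom ≫ α') (hβ : F'.map β ≫ w.hom = w₂.hom ≫ β')
    {y₁ : F'.obj B₁ ⟶ U₁} (hy₁ : y₁ = F'.map x₁.hom ≫ w₁.hom)
    {y₂ : F'.obj B₂ ⟶ U₂} (hy₂ : y₂ = F'.map x₂.hom ≫ w₂.hom)
    {γ : V ⟶ V₂} {t₁ : U₁ ⟶ V₁} {t₂ : U₂ ⟶ V₂} {φ : V₁ ⟶ V₂}
    (h₁ : α' ≫ γ = t₁ ≫ φ) (h₂ : β' ≫ γ = t₂)
    (s₁ : W₁ ≅ V₁) (s₂ : W₂ ≅ V₂) {R : W₁ ⟶ W₂} (hR : s₁.inv ≫ R = φ ≫ s₂.inv) :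
    ∃ f : A₁ ⟶ A₂, F'.map f ≫ F'.map r₂.hom ≫ y₂ ≫ t₂ ≫ s₂.inv =
      (F'.map r₁.hom ≫ y₁ ≫ t₁ ≫ s₁.inv) ≫ R := by
  refine ⟨r₁.hom ≫ x₁.hom ≫ α ≫ inv β ≫ x₂.inv ≫ r₂.inv, ?_⟩
  have hβ' : F'.map (inv β) ≫ w₂.hom ≫ β' = w.hom := by
    rw [← hβ, ← F'.map_comp_assoc, IsIso.inv_hom_id, F'.map_id, Category.id_comp]
  subst hy₁ hy₂ h₂
  simp only [Functor.map_comp, Category.assoc, ← F'.map_comp_assoc r₂.inv, Iso.inv_hom_id, F'.map_id,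
    Category.id_comp, ← F'.map_comp_assoc x₂.inv, hR]
  rw [reassoc_of% hβ', reassoc_of% hα, reassoc_of% h₁]

lemma map_comp_map_comp_eq {M D : Type*} [Category M] [Category D] (F : M ⥤ D) {X Y Z W : M}
    {j : X ⟶ Y} {a : Y ⟶ Z} {δ : X ⟶ W} {k : W ⟶ Z} (h : j ≫ a = δ ≫ k) {V : D}
    {c : F.obj Z ⟶ V} {l : F.obj W ⟶ V} (h' : F.map k ≫ c = l) :
    F.map j ≫ F.map a ≫ c = F.map δ ≫ l := by
  rw [← F.map_comp_assoc, h, F.map_comp, Category.assoc, h']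

lemma homologyMap_map_comp {D D' : Type*} [Category D] [Category D'] [Abelian D] [Abelian D']
    (G : D ⥤ D') [G.Additive] {K L M : CochainComplex D ℕ} (φ : K ⟶ L) (ψ : L ⟶ M) (i : ℕ) :
    HomologicalComplex.homologyMap ((G.mapHomologicalComplex (ComplexShape.up ℕ)).map (φ ≫ ψ)) i =
      HomologicalComplex.homologyMap ((G.mapHomologicalComplex (ComplexShape.up ℕ)).map φ) i ≫
      HomologicalComplex.homologyMap ((G.mapHomologicalComplex (ComplexShape.up ℕ)).map ψ) i := by
  rw [Functor.map_comp, HomologicalComplex.homologyMap_comp]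

variable {C M D C' D' : Type*} [Category C] [Category M] [Category D] [Category C'] [Category D']
  [Abelian C] [Abelian M] [Abelian D] [Abelian C'] [Abelian D']
  [HasInjectiveResolutions C] [HasInjectiveResolutions M] [HasInjectiveResolutions D]
  {F₁ : C ⥤ M} [F₁.Additive] [PreservesFiniteLimits F₁] [PreservesFiniteColimits F₁]
  {F₂ : M ⥤ D} [F₂.Additive] [PreservesFiniteLimits F₂] [PreservesFiniteColimits F₂]
  {G : C ⥤ C'} [G.Additive] {H : M ⥤ C'} [H.Additive] {G' : D ⥤ D'} [G'.Additive]
  {F' : C' ⥤ D'} [F'.Additive] [PreservesFiniteLimits F'] [PreservesFiniteColimits F']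
  [F'.Faithful]

/-- Let `F : C ⥤ D` be an exact functor which is the composition of exact functors `F₁ : C ⥤ M`
and `F₂ : M ⥤ D`, and let `G`, `H`, `G'` be compatible functors on `C`, `M`, `D`. Then a morphism
`δ : F₁ E₁ ⟶ F₁ E₂` induces morphisms between the right derived functors of `G`. -/
theorem existsUnique_rightDerived_map {P : ObjectProperty D} (hP : IsAdapted G' P)
    (hC : ∀ X : C, Injective X → P ((F₁ ⋙ F₂).obj X))
    (hM : ∀ X : M, Injective X → P (F₂.obj X)) (hD : ∀ X : D, Injective X → P X)
    (e₁ : G ≅ F₁ ⋙ H) (e₂ : H ⋙ F' ≅ F₂ ⋙ G')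
    (e : G ⋙ F' ≅ (F₁ ⋙ F₂) ⋙ G')
    (he : ∀ X : C, e.hom.app X = F'.map (e₁.hom.app X) ≫ e₂.hom.app (F₁.obj X))
    {E₁ E₂ : C} (δ : F₁.obj E₁ ⟶ F₁.obj E₂) (i : ℕ) :
    ∃! f : (G.rightDerived i).obj E₁ ⟶ (G.rightDerived i).obj E₂,
      F'.map f ≫ derivedComparison e i E₂ =
        derivedComparison e i E₁ ≫ (G'.rightDerived i).map (F₂.map δ) := by
  have := isIso_derivedComparison e hP hC hD i E₂
  refine existsUnique_of_exists_of_unique ?_ fun f g hf hg => F'.map_injective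
    ((cancel_mono (derivedComparison e i E₂)).1 (hf.trans hg.symm))
  let I₁ := injectiveResolution E₁
  let I₂ := injectiveResolution E₂
  let J₁ : InjectiveResolution (F₂.obj (F₁.obj E₁)) := injectiveResolution ((F₁ ⋙ F₂).obj E₁)
  let J₂ : InjectiveResolution (F₂.obj (F₁.obj E₂)) := injectiveResolution ((F₁ ⋙ F₂).obj E₂)
  let K₁ := injectiveResolution (F₁.obj E₁)
  let K₂ := injectiveResolution (F₁.obj E₂)
  -- `a` lies over `δ` and `b` over the identity of `F₁ E₂`, with common target `K₂`.
  let a := liftResolution F₁ I₁ K₁ ≫ InjectiveResolution.desc δ K₂ K₁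
  let b := liftResolution F₁ I₂ K₂
  let c := liftResolution F₂ K₂ J₂
  let θ₁ := liftResolution (F₁ ⋙ F₂) I₁ J₁
  let θ₂ := liftResolution (F₁ ⋙ F₂) I₂ J₂
  let Φ := InjectiveResolution.desc (F₂.map δ) J₂ J₁
  have ha : F₁.map (augmentation I₁) ≫ a.f 0 = δ ≫ augmentation K₂ := by
    refine Eq.trans ?_ (InjectiveResolution.desc_commutes_zero δ K₂ K₁)
    exact (Category.assoc _ _ _).symm.trans
      (congrArg (· ≫ _) (map_augmentation_liftResolution F₁ I₁ K₁))
  have hb : F₁.map (augmentation I₂) ≫ b.f 0 = augmentation K₂ :=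
    map_augmentation_liftResolution F₁ I₂ K₂
  have hc : F₂.map (augmentation K₂) ≫ c.f 0 = augmentation J₂ :=
    map_augmentation_liftResolution F₂ K₂ J₂
  have hΦ : augmentation J₁ ≫ Φ.f 0 = F₂.map δ ≫ augmentation J₂ :=
    InjectiveResolution.desc_commutes_zero (F₂.map δ) J₂ J₁
  have hθ₁ : F₂.map (F₁.map (augmentation I₁)) ≫ θ₁.f 0 = augmentation J₁ :=
    map_augmentation_liftResolution (F₁ ⋙ F₂) I₁ J₁
  have hθ₂ : F₂.map (F₁.map (augmentation I₂)) ≫ θ₂.f 0 = augmentation J₂ :=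
    map_augmentation_liftResolution (F₁ ⋙ F₂) I₂ J₂
  -- Both composites run from the image of `I₁` to `J₂` and extend `F₂.map δ`, hence agree in
  -- homology; in `h₂` both extend the identity.
  have h₁ := (homologyMap_map_comp G'
    ((F₂.mapHomologicalComplex (ComplexShape.up ℕ)).map a) c i).symm.trans
      ((homologyMap_map_eq (F := F₁ ⋙ F₂) (I := I₁) G'
        ((F₂.mapHomologicalComplex (ComplexShape.up ℕ)).map a ≫ c) (θ₁ ≫ Φ)
        ((map_comp_map_comp_eq F₂ ha hc).trans (hΦ.symm.trans
          ((congrArg (· ≫ Φ.f 0) hθ₁).symm.trans (Category.assoc _ _ _)))) i).trans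
      (homologyMap_map_comp G' θ₁ Φ i))
  have h₂ := (homologyMap_map_comp G'
    ((F₂.mapHomologicalComplex (ComplexShape.up ℕ)).map b) c i).symm.trans
      (homologyMap_map_eq (F := F₁ ⋙ F₂) (I := I₂) G'
        ((F₂.mapHomologicalComplex (ComplexShape.up ℕ)).map b ≫ c) θ₂
        ((map_comp_map_comp_eq F₂ (hb.trans (Category.id_comp _).symm) hc).trans
          ((congrArg (· ≫ augmentation J₂) (F₂.map_id _)).trans
            ((Category.id_comp _).trans hθ₂.symm))) i)
  -- The terms of `F₁ I₂` need not be injective, so `b` need not be a homotopy equivalence; but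
  -- after `F₂` all terms lie in `P`.
  have : QuasiIso ((H.mapHomologicalComplex (ComplexShape.up ℕ)).map b) := by
    rw [quasiIso_iff_of_iso e₂]
    have := quasiIso_liftResolution F₁ I₂ K₂
    exact hP.quasiIso_map ((F₂.mapHomologicalComplex (ComplexShape.up ℕ)).map b)
      (fun _ => hC _ inferInstance) (fun _ => hM _ inferInstance)
  have hb' : IsIso (HomologicalComplex.homologyMap
      ((H.mapHomologicalComplex (ComplexShape.up ℕ)).map b) i) := inferInstance
  have hx {Z : C} (I : InjectiveResolution Z) :
      (mapHomologyComplexIso e i I.cocomplex).hom =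
        F'.map (HomologicalComplex.homologyMap
          ((NatTrans.mapHomologicalComplex e₁.hom (ComplexShape.up ℕ)).app I.cocomplex) i) ≫
        (mapHomologyComplexIso e₂ i
          ((F₁.mapHomologicalComplex (ComplexShape.up ℕ)).obj I.cocomplex)).hom := by
    have : (mapComplexIso e I.cocomplex).hom = (F'.mapHomologicalComplex (ComplexShape.up ℕ)).map
        ((NatTrans.mapHomologicalComplex e₁.hom (ComplexShape.up ℕ)).app I.cocomplex) ≫
        (mapComplexIso e₂ ((F₁.mapHomologicalComplex (ComplexShape.up ℕ)).obj I.cocomplex)).hom := by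
      ext n
      exact he _
    rw [mapHomologyComplexIso_hom, mapHomologyComplexIso_hom]
    refine ((congrArg (fun φ => _ ≫ HomologicalComplex.homologyMap φ i) this).trans ?_).trans
      ((reassoc_of% mapHomologyIso_hom_naturality (F' := F')) i _ _).symm
    exact congrArg (fun ψ => _ ≫ ψ) (HomologicalComplex.homologyMap_comp _ _ i)
  rw [derivedComparison_eq, derivedComparison_eq]
  exact exists_map_comp_eq (rightDerivedIso G i E₁) (rightDerivedIso G i E₂)
    ((HomologicalComplex.homologyFunctor C' _ i).mapIso
      ((NatIso.mapHomologicalComplex e₁ (ComplexShape.up ℕ)).app I₁.cocomplex))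
    ((HomologicalComplex.homologyFunctor C' _ i).mapIso
      ((NatIso.mapHomologicalComplex e₁ (ComplexShape.up ℕ)).app I₂.cocomplex))
    (HomologicalComplex.homologyMap ((H.mapHomologicalComplex (ComplexShape.up ℕ)).map a) i)
    (HomologicalComplex.homologyMap ((H.mapHomologicalComplex (ComplexShape.up ℕ)).map b) i)
    hb' _ _ _ (mapHomologyComplexIso_hom_naturality e₂ i a)
    (mapHomologyComplexIso_hom_naturality e₂ i b) (hx I₁) (hx I₂) h₁ h₂ _ _
    (rightDerivedIso_inv_naturality G' i (F₂.map δ))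

end Main

/-! ### Injective sheaves are flasque, and flasque sheaves are adapted to direct images. -/

section Flasque

/-- By Yoneda, a section over `V` is a map from the presheaf represented by `V`; injectivity extends
it along the monomorphism to the one represented by `U`. -/
lemma surjective_map_of_injective {C : Type u} [SmallCategory C] (P : Cᵒᵖ ⥤ Type u) [Injective P]
    {U V : C} (i : V ⟶ U) [Mono i] : Function.Surjective (P.map i.op) := by
  intro s
  have : Mono (yoneda.map i) := inferInstance
  refine ⟨yonedaEquiv (Injective.factorThru (yonedaEquiv.symm s) (yoneda.map i)), ?_⟩
  exact (yonedaEquiv_naturality _ i).trans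
    ((congrArg yonedaEquiv (Injective.comp_factorThru _ _)).trans (Equiv.apply_symm_apply _ _))

/-- Needed because a right adjoint preserves injectives when its left adjoint preserves
monomorphisms: injectivity thus descends to presheaves of sets. -/
instance preservesMonomorphisms_free {C : Type u} [SmallCategory C] (R : Cᵒᵖ ⥤ RingCat.{u}) :
    (PresheafOfModules.free R).PreservesMonomorphisms where
  preserves {F G} φ _ := by
    refine PresheafOfModules.mono_of_injective fun U => ?_
    have : Function.Injective (φ.app U) := (mono_iff_injective _).1 inferInstance
    exact Finsupp.mapDomain_injective this

instance preservesMonomorphisms_whiskeringRight_free {C : Type u} [SmallCategory C] :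
    ((Functor.whiskeringRight C _ _).obj AddCommGrpCat.free.{u}).PreservesMonomorphisms where
  preserves {F G} φ _ := by
    have (U : C) : Mono ((((Functor.whiskeringRight C _ _).obj AddCommGrpCat.free.{u}).map φ).app U) :=
      inferInstanceAs (Mono (AddCommGrpCat.free.map (φ.app U)))
    exact NatTrans.mono_of_mono_app _

variable {T : TopCat.{u}}

lemma isFlasque_of_injective_comp_forget (F : TopCat.Sheaf AddCommGrpCat.{u} T)
    (h : Injective (F.obj ⋙ forget AddCommGrpCat.{u})) : TopCat.Sheaf.IsFlasque F where
  epi i := (AddCommGrpCat.epi_iff_surjective _).2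
    (surjective_map_of_injective (F.obj ⋙ forget AddCommGrpCat.{u}) i.unop)

/-- An injective sheaf of abelian groups is flasque. -/
lemma isFlasque_of_injective (F : TopCat.Sheaf AddCommGrpCat.{u} T) (hF : Injective F) :
    TopCat.Sheaf.IsFlasque F := by
  have : Injective F.obj := @Injective.injective_of_adjoint _ _ _ _ _ _ inferInstance
    (sheafificationAdjunction (Opens.grothendieckTopology T) AddCommGrpCat.{u}) F hF
  exact isFlasque_of_injective_comp_forget F
    (Injective.injective_of_adjoint (AddCommGrpCat.adj.whiskerRight _) F.obj)

/-- The sheaf of abelian groups underlying an injective sheaf of modules is flasque. -/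
lemma isFlasque_toSheaf_of_injective
    (R : CategoryTheory.Sheaf (Opens.grothendieckTopology T) RingCat.{u}) (M : SheafOfModules.{u} R)
    [Injective M] : TopCat.Sheaf.IsFlasque ((SheafOfModules.toSheaf R).obj M) := by
  have := Injective.injective_of_adjoint (PresheafOfModules.sheafificationAdjunction (𝟙 R.obj)) M
  exact isFlasque_of_injective_comp_forget ((SheafOfModules.toSheaf R).obj M)
    (Injective.injective_of_adjoint (PresheafOfModules.freeAdjunction _)
      ((SheafOfModules.forget R ⋙ PresheafOfModules.restrictScalars (𝟙 R.obj)).obj M))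

variable {T' : TopCat.{u}} (f : T ⟶ T')

/-- The class of flasque sheaves of abelian groups. -/
def flasque (T : TopCat.{u}) : ObjectProperty (TopCat.Sheaf AddCommGrpCat.{u} T) :=
  fun F => TopCat.Sheaf.IsFlasque F

lemma flasque_of_retract {F G : TopCat.Sheaf AddCommGrpCat.{u} T} (hF : flasque T F) (r : Retract G F) :
    flasque T G := ⟨fun {U V} i => by
  have := hF.epi i
  have hr : r.i.hom.app V ≫ r.r.hom.app V = 𝟙 _ := congrArg (fun φ => φ.hom.app V) r.retract
  have : IsSplitEpi (r.r.hom.app V) := ⟨⟨⟨_, hr⟩⟩⟩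
  have h : Epi (r.r.hom.app U ≫ G.obj.map i) := by
    rw [← r.r.hom.naturality i]
    exact epi_comp _ _
  exact epi_of_epi (r.r.hom.app U) _⟩

lemma flasque_biprod {F G : TopCat.Sheaf AddCommGrpCat.{u} T} (hF : flasque T F) (hG : flasque T G) :
    flasque T (F ⊞ G) := ⟨fun {U V} i => by
  have := hF.epi i
  have := hG.epi i
  refine Preadditive.epi_of_cancel_zero _ fun {P} g hg => ?_
  have h₁ : (biprod.inl : F ⟶ F ⊞ G).hom.app V ≫ g = 0 := by
    rw [← cancel_epi (F.obj.map i), ← Category.assoc, (biprod.inl : F ⟶ F ⊞ G).hom.naturality i,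
      Category.assoc, hg, comp_zero, comp_zero]
  have h₂ : (biprod.inr : G ⟶ F ⊞ G).hom.app V ≫ g = 0 := by
    rw [← cancel_epi (G.obj.map i), ← Category.assoc, (biprod.inr : G ⟶ F ⊞ G).hom.naturality i,
      Category.assoc, hg, comp_zero, comp_zero]
  have h : (biprod.fst : F ⊞ G ⟶ F).hom.app V ≫ (biprod.inl : F ⟶ F ⊞ G).hom.app V +
      (biprod.snd : F ⊞ G ⟶ G).hom.app V ≫ (biprod.inr : G ⟶ F ⊞ G).hom.app V = 𝟙 _ :=
    congrArg (fun φ => φ.hom.app V) (biprod.total (X := F) (Y := G))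
  rw [← Category.id_comp g, ← h, Preadditive.add_comp, Category.assoc, Category.assoc, h₁, h₂,
    comp_zero, comp_zero, add_zero]⟩

/-- The direct image functor sends a short exact sequence with flasque kernel to a short exact
sequence. -/
lemma isAdapted_flasque [(TopCat.Sheaf.pushforward AddCommGrpCat.{u} f).Additive] :
    IsAdapted (TopCat.Sheaf.pushforward AddCommGrpCat.{u} f) (flasque T) where
  of_iso e h := flasque_of_retract h e.symm.retract
  of_isZero h := isFlasque_of_injective _ h.injective
  biprod := flasque_biprod
  of_shortExact hS h₁ h₂ := by
    have : TopCat.Sheaf.IsFlasque _ := h₁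
    have : TopCat.Sheaf.IsFlasque _ := h₂
    exact TopCat.Sheaf.IsFlasque.of_shortExact_of_isFlasque₁₂ hS
  map_shortExact {S} hS h₁ := by
    have : TopCat.Sheaf.IsFlasque _ := h₁
    have := hS.mono_f
    refine
      { exact := hS.exact.map_of_mono_of_preservesKernel _ hS.mono_f inferInstance
        mono_f := inferInstanceAs (Mono ((TopCat.Sheaf.pushforward AddCommGrpCat.{u} f).map S.f))
        epi_g := ?_ }
    -- A flasque kernel makes `S.g` surjective on sections over every open set, in particular over
    -- preimages under `f`.
    · have (U : (Opens T')ᵒᵖ) : Epi (((TopCat.Sheaf.pushforward AddCommGrpCat.{u} f).map S.g).hom.app U) :=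
        TopCat.Sheaf.IsFlasque.epi_of_shortExact hS
      have : Epi ((TopCat.Sheaf.pushforward AddCommGrpCat.{u} f).map S.g).hom :=
        NatTrans.epi_of_epi_app _
      exact (sheafToPresheaf _ _).epi_of_epi_map this

end Flasque

/-! ### Exactness of restriction of scalars, tested on underlying abelian sheaves. -/

section RestrictScalars

variable {T : TopCat.{u}} {R R' : CategoryTheory.Sheaf (Opens.grothendieckTopology T) RingCat.{u}}
  (α : R ⟶ R')

instance preservesFiniteLimits_restrictScalars :
    PreservesFiniteLimits (SheafOfModules.restrictScalars.{u} α) := by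
  have : PreservesFiniteLimits (SheafOfModules.restrictScalars.{u} α ⋙ SheafOfModules.toSheaf R) :=
    inferInstanceAs (PreservesFiniteLimits (SheafOfModules.toSheaf R'))
  exact preservesFiniteLimits_of_reflects_of_preserves _ (SheafOfModules.toSheaf R)

instance preservesFiniteColimits_restrictScalars :
    PreservesFiniteColimits (SheafOfModules.restrictScalars.{u} α) := by
  have : PreservesFiniteColimits (SheafOfModules.restrictScalars.{u} α ⋙ SheafOfModules.toSheaf R) :=
    inferInstanceAs (PreservesFiniteColimits (SheafOfModules.toSheaf R'))
  have : ReflectsFiniteColimits (SheafOfModules.toSheaf.{u} R) :=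
    { reflects := fun _ _ _ => reflectsColimitsOfShape_of_reflectsIsomorphisms }
  exact preservesFiniteColimits_of_reflects_of_preserves _ (SheafOfModules.toSheaf R)

end RestrictScalars

/-! ### Factoring the direct image through `q⁻¹ 𝒪_S`-modules. -/

variable {X S : Scheme.{u}} (q : X ⟶ S)

/-- The sheaf of rings `q⁻¹ 𝒪_S`, without the commutativity. -/
abbrev baseRingCat : TopCat.Sheaf RingCat.{u} X :=
  (sheafCompose _ (forget₂ CommRingCat RingCat.{u})).obj (baseRing q)

/-- The structure map `q⁻¹ 𝒪_S ⟶ 𝒪_X`. -/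
def baseRingCatHom : baseRingCat q ⟶ X.ringCatSheaf :=
  (sheafCompose _ (forget₂ CommRingCat RingCat.{u})).map (baseRingHom q)

/-- The unit `𝒪_S ⟶ q_* q⁻¹ 𝒪_S`. -/
def toPushforwardBaseRingCat : S.ringCatSheaf ⟶
    ((Opens.map q.base).sheafPushforwardContinuous _ _ _).obj (baseRingCat q) where
  hom := Functor.whiskerRight
    ((TopCat.Sheaf.pullbackPushforwardAdjunction CommRingCat.{u} q.base).unit.app S.sheaf).hom _

/-- `baseRingHom` is by definition adjoint to `q.c`, so composing its direct image with the unit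
gives `q.c` back. -/
lemma toPushforwardBaseRingCat_comp :
    q.toRingCatSheafHom = toPushforwardBaseRingCat q ≫
      ((Opens.map q.base).sheafPushforwardContinuous _ _ _).map (baseRingCatHom q) := by
  let adj := TopCat.Sheaf.pullbackPushforwardAdjunction CommRingCat.{u} q.base
  have h : adj.unit.app S.sheaf ≫ (TopCat.Sheaf.pushforward CommRingCat.{u} q.base).map
      (baseRingHom q) = ⟨q.c⟩ :=
    (adj.homEquiv_unit S.sheaf X.sheaf _).symm.trans (Equiv.apply_symm_apply _ _)
  exact (congrArg (fun φ : S.sheaf ⟶ (TopCat.Sheaf.pushforward CommRingCat.{u} q.base).obj X.sheaf =>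
    (⟨Functor.whiskerRight φ.hom (forget₂ CommRingCat RingCat.{u})⟩ : S.ringCatSheaf ⟶
      ((Opens.map q.base).sheafPushforwardContinuous _ _ _).obj X.ringCatSheaf)) h).symm

/-- The functor which considers an `𝒪_X`-module as a `q⁻¹ 𝒪_S`-module. -/
def toBaseModules : X.Modules ⥤ SheafOfModules.{u} (baseRingCat q) :=
  SheafOfModules.restrictScalars (baseRingCatHom q)

instance additive_toBaseModules : (toBaseModules q).Additive where

instance preservesFiniteLimits_toBaseModules : PreservesFiniteLimits (toBaseModules q) :=
  preservesFiniteLimits_restrictScalars (baseRingCatHom q)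

instance preservesFiniteColimits_toBaseModules : PreservesFiniteColimits (toBaseModules q) :=
  preservesFiniteColimits_restrictScalars (baseRingCatHom q)

/-- The functor taking a `q⁻¹ 𝒪_S`-module to its underlying sheaf of abelian groups. -/
def baseModulesToAb : SheafOfModules.{u} (baseRingCat q) ⥤ TopCat.Sheaf AddCommGrpCat.{u} X :=
  SheafOfModules.toSheaf (baseRingCat q)

instance additive_baseModulesToAb : (baseModulesToAb q).Additive where

instance preservesFiniteLimits_baseModulesToAb : PreservesFiniteLimits (baseModulesToAb q) :=
  inferInstanceAs (PreservesFiniteLimits (SheafOfModules.toSheaf (baseRingCat q)))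

instance preservesFiniteColimits_baseModulesToAb : PreservesFiniteColimits (baseModulesToAb q) :=
  preservesFiniteColimits_toSheaf (baseRingCat q)

/-- The direct image functor from `q⁻¹ 𝒪_S`-modules to `𝒪_S`-modules. -/
def pushforwardBase : SheafOfModules.{u} (baseRingCat q) ⥤ S.Modules :=
  SheafOfModules.pushforward (toPushforwardBaseRingCat q)

instance additive_pushforwardBase : (pushforwardBase q).Additive where

/-- The direct image of an `𝒪_X`-module can be computed on the underlying `q⁻¹ 𝒪_S`-module. -/
def pushforwardIso : Scheme.Modules.pushforward q ≅ toBaseModules q ⋙ pushforwardBase q :=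
  SheafOfModules.pushforwardCongr (toPushforwardBaseRingCat_comp q)

/-- Taking direct images commutes with passing from `q⁻¹ 𝒪_S`-modules to abelian sheaves. -/
def pushforwardBaseCompToAb : pushforwardBase q ⋙ toAb S ≅
    baseModulesToAb q ⋙ TopCat.Sheaf.pushforward AddCommGrpCat.{u} q.base :=
  Iso.refl (pushforwardBase q ⋙ toAb S)

/-- Taking direct images commutes with passing from `𝒪_X`-modules to abelian sheaves. -/
def pushforwardCompToAb : Scheme.Modules.pushforward q ⋙ toAb S ≅
    (toBaseModules q ⋙ baseModulesToAb q) ⋙ TopCat.Sheaf.pushforward AddCommGrpCat.{u} q.base :=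
  Iso.refl (Scheme.Modules.pushforward q ⋙ toAb S)

lemma pushforwardCompToAb_hom_app (M : X.Modules) : (pushforwardCompToAb q).hom.app M =
    (toAb S).map ((pushforwardIso q).hom.app M) ≫
      (pushforwardBaseCompToAb q).hom.app ((toBaseModules q).obj M) :=
  rfl

instance faithful_toAb (X : Scheme.{u}) : (toAb X).Faithful :=
  inferInstanceAs (SheafOfModules.toSheaf X.ringCatSheaf).Faithful

/-! ### Differential operators are `q⁻¹ 𝒪_S`-linear. -/

lemma jetMk_one_smul (E : X.Modules) (N : ℕ) (U : X.Opens) (a : (baseRing q).obj.obj (op U))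
    (m : Γ(E, U)) :
    jetMk q E N U 1 (algebraMap _ Γ(X, U) a • m) =
      algebraMap ((baseRing q).obj.obj (op U)) Γ(X, U) a • jetMk q E N U 1 m := by
  have h : (1 : Γ(X, U)) ⊗ₜ[(baseRing q).obj.obj (op U)] (a • m) =
      (algebraMap ((baseRing q).obj.obj (op U)) Γ(X, U) a) • ((1 : Γ(X, U)) ⊗ₜ m) := by
    -- `a` crosses the tensor sign, so linearity already holds before dividing by `I ^ (N + 1)`.
    rw [← TensorProduct.smul_tmul, TensorProduct.smul_tmul', Algebra.smul_def, smul_eq_mul]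
  exact congrArg Submodule.Quotient.mk h

lemma appAb_universalDerivation_smul (E : X.Modules) (N : ℕ) (U : X.Opens)
    (a : (baseRing q).obj.obj (op U)) (m : Γ(E, U)) :
    appAb (universalDerivation q E N) U (algebraMap _ Γ(X, U) a • m) =
      algebraMap ((baseRing q).obj.obj (op U)) Γ(X, U) a •
        appAb (universalDerivation q E N) U m := by
  let η := (PresheafOfModules.sheafificationAdjunction (𝟙 X.ringCatSheaf.obj)).unit.app
    (jetPresheaf q E N)
  -- Sheafification of abelian presheaves underlies the unit `η` for modules, which is `𝒪_X`-linear.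
  have h (m : Γ(E, U)) : appAb (universalDerivation q E N) U m =
    η.app (op U) (jetMk q E N U 1 m) := rfl
  rw [h, h, jetMk_one_smul]
  exact (η.app (op U)).hom.map_smul _ _

/-- A differential operator relative to `S` is `q⁻¹ 𝒪_S`-linear. -/
lemma IsDiffOp.map_smul {N : ℕ} {E₁ E₂ : X.Modules} {D : (toAb X).obj E₁ ⟶ (toAb X).obj E₂}
    (hD : IsDiffOp q N D) (U : X.Opens) (a : (baseRing q).obj.obj (op U)) (m : Γ(E₁, U)) :
    appAb D U (algebraMap _ Γ(X, U) a • m) =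
      algebraMap ((baseRing q).obj.obj (op U)) Γ(X, U) a • appAb D U m := by
  obtain ⟨D', rfl⟩ := hD.exists_factorization
  have h (m : Γ(E₁, U)) : appAb (universalDerivation q E₁ N ≫ (toAb X).map D') U m =
    D'.app U (appAb (universalDerivation q E₁ N) U m) := rfl
  rw [h, h, appAb_universalDerivation_smul, Scheme.Modules.Hom.app_smul]

lemma IsDiffOp.exists_baseModulesToAb_map_eq {N : ℕ} {E₁ E₂ : X.Modules}
    {D : (toAb X).obj E₁ ⟶ (toAb X).obj E₂} (hD : IsDiffOp q N D) :
    ∃ δ : (toBaseModules q).obj E₁ ⟶ (toBaseModules q).obj E₂, (baseModulesToAb q).map δ = D :=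
  ⟨⟨PresheafOfModules.homMk D.hom fun U a m => hD.map_smul q U.unop a m⟩, rfl⟩

end RelDiffOp

end

theorem mainTheorem10 {X S : AlgebraicGeometry.Scheme.{u}} (q : X ⟶ S)
    [AlgebraicGeometry.IsNoetherian X] [AlgebraicGeometry.IsNoetherian S]
    [AlgebraicGeometry.IsProper q]
    (E₁ E₂ : X.Modules) (hE₁ : RelDiffOp.IsCoherent E₁) (hE₂ : RelDiffOp.IsCoherent E₂)
    (N : ℕ) (D : (RelDiffOp.toAb X).obj E₁ ⟶ (RelDiffOp.toAb X).obj E₂)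
    (hD : RelDiffOp.IsDiffOp q N D) (i : ℕ) :
    ∃! f : (RelDiffOp.higherDirectImage q i).obj E₁ ⟶ (RelDiffOp.higherDirectImage q i).obj E₂,
      RelDiffOp.IsInducedBy q i D f := by
  obtain ⟨δ, rfl⟩ := hD.exists_baseModulesToAb_map_eq
  exact RelDiffOp.existsUnique_rightDerived_map (F₁ := RelDiffOp.toBaseModules q)
    (F₂ := RelDiffOp.baseModulesToAb q) (H := RelDiffOp.pushforwardBase q)
    (RelDiffOp.isAdapted_flasque q.base)
    (fun M hM => @RelDiffOp.isFlasque_toSheaf_of_injective _ X.ringCatSheaf M hM)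
    (fun M hM => @RelDiffOp.isFlasque_toSheaf_of_injective _ (RelDiffOp.baseRingCat q) M hM)
    RelDiffOp.isFlasque_of_injective (RelDiffOp.pushforwardIso q)
    (RelDiffOp.pushforwardBaseCompToAb q) (RelDiffOp.pushforwardCompToAb q)
    (RelDiffOp.pushforwardCompToAb_hom_app q) δ i
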